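/- Let $G$ be a finite simple graph with adjacency matrix $M$, let $T$ be an automorphism of $G$ of order $r$, and let $K\subseteq V(G)$ be an orbit of (the cyclic group generated by) $T$ with $|K|=r$. Let $d$ be the largest distance from $K$ to a vertex of $G$, that is, the maximum of $\mathrm{dist}(K,x)=\min_{y\in K}\mathrm{dist}(y,x)$ over all vertices $x$ of $G$ for which this distance is finite (so over all vertices, if $G$ is connected). Let $D_K$ be the diagonal $V(G)\times V(G)$ matrix whose diagonal entries are $1$ in $K$ and $0$ outside $K$. If $r(d+1)>|V(G)|$, then for every real number $Q$ that is transcendental (over $\mathbb{Q}$) the matrix $M^K=M+Q\cdot D_K$ exhibits pretty good fractional revival with respect to $K$; that is, the closure of the set $\{\exp(itM^K)_{K\times K} : t\ge 0\}$ of $K\times K$ submatrices contains a unitary $K\times K$ matrix that is not a scalar multiple of the identity. -/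

import Mathlib

/-- The diagonal matrix `D_K`, with diagonal entries `1` in `K` and `0` outside `K`. -/
def diagIndicator {X : Type*} [DecidableEq X] (K : Finset X) : Matrix X X ℝ :=
  Matrix.diagonal fun x => if x ∈ K then 1 else 0

/-- The continuous-time quantum walk `exp (i t M)` of a real matrix `M`. -/
noncomputable def quantumWalk {X : Type*} [Fintype X] [DecidableEq X]
    (M : Matrix X X ℝ) (t : ℝ) : Matrix X X ℂ :=
  NormedSpace.exp ((Complex.I * (t : ℂ)) • M.map (fun a : ℝ => (a : ℂ)))

/-- The `K × K` submatrix of an `X × X` matrix. -/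
def restrictTo {X : Type*} (K : Finset X) (A : Matrix X X ℂ) : Matrix K K ℂ :=
  A.submatrix (fun x : K => (x : X)) (fun x : K => (x : X))

/-- Pretty good fractional revival of `M` with respect to `K`: the closure of the set of
`K × K` submatrices of `exp (i t M)`, `t ≥ 0`, contains a unitary matrix that is not a scalar
multiple of the identity. -/
def PrettyGoodFractionalRevival {X : Type*} [Fintype X] [DecidableEq X]
    (M : Matrix X X ℝ) (K : Finset X) : Prop :=
  ¬ (closure {B : Matrix K K ℂ | ∃ t : ℝ, 0 ≤ t ∧ B = restrictTo K (quantumWalk M t)} ∩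
        (Matrix.unitaryGroup K ℂ : Set (Matrix K K ℂ)) ⊆
      {B : Matrix K K ℂ | ∃ ρ : ℂ, B = ρ • (1 : Matrix K K ℂ)})

/-- The distance from the set `K` to the node `x` in the graph `G`
(infinite if no node of `K` is joined to `x` by a walk). -/
noncomputable def distFromSet {V : Type*} (G : SimpleGraph V) (K : Finset V) (x : V) : ℕ∞ :=
  ⨅ y ∈ K, G.edist y x

/-!
Let `ζ` be a primitive `r`-th root of unity and let `v` be a vertex of the orbit `K`. For every
power `ω` of `ζ` there is a vector `u` supported on `K` with `u (T ^ j v) = ω ^ j`; these vectors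
span the functions on `K`. On functions `w` with `w ∘ T = ω w` the matrix `D_K` has rank one,
`D_K w = w v • u`, so that the Krylov space of `u` under the adjacency matrix `M` is also invariant
under `A = M + Q D_K`. Let `p` be the monic generator of the ideal of polynomials `h` with
`h(M) u = 0`, and `n = deg p` the dimension of that Krylov space.

An eigenvalue `μ` of `A` on the Krylov space satisfies `p(μ) = Q q(μ)`, where `q` is the numerator
of `p` times the resolvent function of `u` (`krylovNumerator`). Both polynomials are monic with
algebraic coefficients, `deg q = n - 1`, and they are coprime because `M` is Hermitian. Since `Q` is
transcendental over the field `F` of algebraic numbers, Gauss' lemma makes `p - Q q` irreducible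
over `F(Q)`: it is the minimal polynomial of `μ`, so the normalised trace of `μ` is `(Q + c) / n`
with `c ∈ F`. Composing the normalised trace with an `F`-linear functional that takes `1` to `0` and
`Q` to `1` gives one additive function `g` with `g μ = 1 / n` for all these eigenvalues and all `ω`
at once (`exists_linearMap_mul_natDegree_eq_one`, `exists_additive_apply_eigenvalue_eq`).

Kronecker's theorem, in the form that any additive map `f : ℝ → ℝ` can be approximated on a finite
set in the sense `exp (i t x) ≈ exp (i f x)` with a common time `t ≥ 0`
(`exists_time_approximating_character`), then yields a unitary limit `Z` of `exp (i t A)` which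
acts on every vector `u` as the scalar `exp (i s / n)`, for a real number `s` of our choice. So
`Z` preserves the functions on `K`, and its `K × K` block is unitary.

It remains to see that `n` is not the same for all `ω`. For `ω = 1`, a vertex at distance `d` from
`K` forces `n ≥ d + 1`. The Krylov spaces lie in different eigenspaces of `T`, so their dimensions
add up to at most `|V|`; if they were all equal, `r (d + 1) ≤ |V|` would follow. Choosing `s` so
that two of the phases are opposite, the block is not a scalar matrix.
-/

open scoped Matrix

/-! ### Irreducibility and normalised traces over `F(τ)` -/

open Polynomial IntermediateField in
/-- If `τ` is transcendental over `F` and `p`, `q` are coprime, then `p - τ q` is irreducible over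
`F(τ)`: it is irreducible as a bivariate polynomial because it has degree one in `τ` with coprime
coefficients, and Gauss' lemma applies. -/
theorem irreducible_sub_transcendental_mul {F L : Type*} [Field F] [Field L] [Algebra F L]
    {τ : L} (hτ : Transcendental F τ) {p q : F[X]} (hq : q ≠ 0) (hpq : IsCoprime p q)
    (hdeg : (p.map (algebraMap F F⟮τ⟯) -
      C (AdjoinSimple.gen F τ) * q.map (algebraMap F F⟮τ⟯)).natDegree ≠ 0) :
    Irreducible (p.map (algebraMap F F⟮τ⟯) -
      C (AdjoinSimple.gen F τ) * q.map (algebraMap F F⟮τ⟯)) := by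
  let e : RatFunc F ≃ₐ[F] F⟮τ⟯ := RatFunc.algEquivOfTranscendental τ hτ
  let φ : F[X][X] := p.map C - C X * q.map C
  let ψ : (RatFunc F)[X] := φ.map (algebraMap F[X] (RatFunc F))
  have hψ : ψ.mapEquiv e.toRingEquiv = p.map (algebraMap F F⟮τ⟯) -
      C (AdjoinSimple.gen F τ) * q.map (algebraMap F F⟮τ⟯) := by
    have h : ∀ s : F[X], ((s.map C).map (algebraMap F[X] (RatFunc F))).map
        (e.toRingEquiv : RatFunc F →+* F⟮τ⟯) = s.map (algebraMap F F⟮τ⟯) := by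
      intro s
      rw [Polynomial.map_map, Polynomial.map_map]
      congr 1
      ext x
      simp [e, ← RatFunc.algebraMap_eq_C]
    simp only [ψ, φ, mapEquiv_apply, Polynomial.map_sub, Polynomial.map_mul, h, map_C]
    congr 3
    exact Subtype.ext (by simp [e])
  have hφ : φ = Bivariate.swap (C (-q) * X + C p) := by
    rw [map_add, map_mul, Bivariate.swap_C, Bivariate.swap_C, Bivariate.swap_Y]
    simp only [φ, Polynomial.map_neg]
    ring
  have hirr : Irreducible φ := by
    rw [hφ, MulEquiv.irreducible_iff]
    exact irreducible_C_mul_X_add_C (neg_ne_zero.mpr hq) hpq.symm.neg_left.isRelPrime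
  rw [← hψ, MulEquiv.irreducible_iff]
  refine (IsPrimitive.irreducible_iff_irreducible_map_fraction_map
    (hirr.isPrimitive fun H => hdeg ?_)).1 hirr
  rw [← hψ, mapEquiv_apply]
  have h1 := natDegree_map_le (f := algebraMap F[X] (RatFunc F)) (p := φ)
  have h2 := natDegree_map_le (f := (e.toRingEquiv : RatFunc F →+* F⟮τ⟯)) (p := ψ)
  rw [H] at h1
  exact Nat.le_zero.1 (h2.trans h1)

open IntermediateField in
theorem natDegree_minpoly_mul_trace {E K : Type*} [Field E] [Field K] [Algebra E K]
    [FiniteDimensional E K] (y : K) : (minpoly E y).natDegree • Algebra.trace E K y =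
      Module.finrank E K • -(minpoly E y).nextCoeff := by
  rw [trace_eq_finrank_mul_minpoly_nextCoeff, ← adjoin.finrank (IsIntegral.of_finite E y),
    ← Module.finrank_mul_finrank E E⟮y⟯ K, nsmul_eq_mul, nsmul_eq_mul, Nat.cast_mul, mul_assoc]

open Polynomial IntermediateField in
/-- A linear functional with the value `1 / deg p` at every `x ∈ S` that is a root of a polynomial
`p - τ q` as in the hypotheses. Such an `x` has minimal polynomial `p - τ q` over `F(τ)`, hence
normalised trace `(τ - p.nextCoeff) / deg p`; the functional is the normalised trace followed by a
functional that kills `1` but not `τ`. -/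
theorem exists_linearMap_mul_natDegree_eq_one {F L : Type*} [Field F] [CharZero F] [Field L]
    [Algebra F L] {τ : L} (hτ : Transcendental F τ) (S : Finset L) :
    ∃ f : L →ₗ[F] F, ∀ x ∈ S, ∀ p q : F[X], p.Monic → q.Monic →
      q.natDegree + 1 = p.natDegree → IsCoprime p q → aeval x p = τ * aeval x q →
      f x * p.natDegree = 1 := by
  classical
  let E := F⟮τ⟯
  -- the normalised trace is taken on the field generated by the algebraic elements of `S`
  let S' : Set L := {x ∈ (S : Set L) | IsIntegral E x}
  have : Finite S' := (S.finite_toSet.subset fun _ h => h.1).to_subtype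
  let K := IntermediateField.adjoin E S'
  have hfd : FiniteDimensional E K := finiteDimensional_adjoin fun x hx => hx.2
  have hgen : AdjoinSimple.gen F τ ∉ Submodule.span F {(1 : E)} := by
    rw [Submodule.mem_span_singleton]
    rintro ⟨a, ha⟩
    apply hτ
    have : algebraMap F L a = τ := by
      simpa [Algebra.smul_def] using congrArg (algebraMap E L) ha
    exact this ▸ isAlgebraic_algebraMap a
  obtain ⟨g, hgτ, hg1⟩ := Submodule.exists_le_ker_of_notMem hgen
  have hgF : ∀ a : F, g (algebraMap F E a) = 0 := fun a => by
    rw [Algebra.algebraMap_eq_smul_one, map_smul,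
      show g 1 = 0 from hg1 (Submodule.mem_span_singleton_self _), smul_zero]
  obtain ⟨s, hs⟩ := ((K.val.toLinearMap).restrictScalars F).exists_leftInverse_of_injective
    (LinearMap.ker_eq_bot.2 K.val.injective)
  refine ⟨((g (AdjoinSimple.gen F τ))⁻¹ * (Module.finrank E K : F)⁻¹) •
    (g ∘ₗ (Algebra.trace E K).restrictScalars F ∘ₗ s), ?_⟩
  intro x hx p q hp hq hdeg hpq hxe
  set P := p.map (algebraMap F E) - C (AdjoinSimple.gen F τ) * q.map (algebraMap F E) with hP
  have hlt : (C (AdjoinSimple.gen F τ) * q.map (algebraMap F E)).natDegree <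
      (p.map (algebraMap F E)).natDegree := by
    refine (natDegree_C_mul_le _ _).trans_lt ?_
    rw [natDegree_map, natDegree_map]
    omega
  have hPm : P.Monic := (hp.map _).sub_of_left (degree_lt_degree hlt)
  have hPd : P.natDegree = p.natDegree := by
    rw [hP, natDegree_sub_eq_left_of_natDegree_lt hlt,
      natDegree_map]
  have hPx : aeval x P = 0 := by
    simp [hP, aeval_map_algebraMap, hxe]
  have hPi : Irreducible P :=
    irreducible_sub_transcendental_mul hτ hq.ne_zero hpq (by rw [← hP, hPd]; omega)
  have hmin : minpoly E x = P := (minpoly.eq_of_irreducible_of_monic hPi hPx hPm).symm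
  have hxi : IsIntegral E x := ⟨P, hPm, hPx⟩
  let y : K := ⟨x, subset_adjoin E S' ⟨hx, hxi⟩⟩
  have hsy : s x = y := LinearMap.congr_fun hs y
  have hminy : minpoly E y = P := by rw [← hmin]; exact minpoly_eq y 
  have hnext : P.nextCoeff = algebraMap F E p.nextCoeff - AdjoinSimple.gen F τ := by
    have hlead : q.coeff (p.natDegree - 1) = 1 := by
      rw [show p.natDegree - 1 = q.natDegree by omega]
      exact hq
    rw [nextCoeff_of_natDegree_pos (by omega), nextCoeff_of_natDegree_pos (by omega), hPd, hP,
      coeff_sub, coeff_C_mul, coeff_map, coeff_map, hlead, map_one, mul_one]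
  have hK : (Module.finrank E K : F) ≠ 0 := Nat.cast_ne_zero.2 Module.finrank_pos.ne'
  have htr : (p.natDegree : F) * g (Algebra.trace E K y) =
      Module.finrank E K * g (AdjoinSimple.gen F τ) := by
    have h := congrArg g (natDegree_minpoly_mul_trace (E := E) y)
    rwa [hminy, hnext, hPd, map_nsmul, map_nsmul, neg_sub, map_sub, hgF, sub_zero, nsmul_eq_mul,
      nsmul_eq_mul] at h
  simp only [LinearMap.smul_apply, LinearMap.comp_apply, hsy, LinearMap.restrictScalars_apply,
    smul_eq_mul]
  rw [mul_assoc, mul_comm (g _) (p.natDegree : F), htr]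
  field_simp

/-! ### Kronecker's approximation theorem -/

/-- Two distant points of the unit circle have a sum that is noticeably shorter than `2`. -/
theorem norm_add_le_of_le_norm_sub {z w : ℂ} (hz : ‖z‖ = 1) (hw : ‖w‖ = 1) {ε : ℝ} (hε : 0 ≤ ε)
    (h : ε ≤ ‖z - w‖) : ‖z + w‖ ≤ 2 - ε ^ 2 / 4 := by
  have h1 := parallelogram_law_with_norm ℝ z w
  rw [hz, hw] at h1
  have h2 : ε ^ 2 ≤ ‖z - w‖ ^ 2 := by gcongr
  nlinarith [norm_nonneg (z + w), sq_nonneg (ε ^ 2)]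

open Filter Topology in
theorem tendsto_mean_exp {a : ℝ} (ha : a ≠ 0) :
    Tendsto (fun T : ℝ => (T : ℂ)⁻¹ * ∫ t in (0 : ℝ)..T, Complex.exp (Complex.I * a * t)) atTop
      (𝓝 0) := by
  have hc : Complex.I * (a : ℂ) ≠ 0 := by simp [ha]
  have hT : Tendsto (fun T : ℝ => |a|⁻¹ * 2 * T⁻¹) atTop (𝓝 0) := by
    simpa using tendsto_inv_atTop_zero.const_mul (|a|⁻¹ * 2)
  refine squeeze_zero_norm' ?_ hT
  filter_upwards [eventually_gt_atTop 0] with T hT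
  rw [integral_exp_mul_complex hc, norm_mul, norm_div, norm_inv, norm_mul, Complex.norm_I,
    Complex.norm_real, Complex.norm_real, one_mul, Real.norm_of_nonneg hT.le, Real.norm_eq_abs]
  have : ‖Complex.exp (Complex.I * a * T) - Complex.exp (Complex.I * a * (0 : ℝ))‖ ≤ 2 := by
    refine (norm_sub_le _ _).trans ?_
    have h : ∀ s : ℝ, ‖Complex.exp (Complex.I * a * s)‖ = 1 := fun s => by
      rw [show Complex.I * a * s = ((a * s : ℝ) : ℂ) * Complex.I by push_cast; ring,
        Complex.norm_exp_ofReal_mul_I]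
    rw [h, h]; norm_num
  rw [div_eq_mul_inv]
  have ha' : 0 < |a|⁻¹ := by positivity
  have hT' : 0 < T⁻¹ := by positivity
  nlinarith [mul_le_mul_of_nonneg_right this (mul_pos hT' ha').le]

open Filter Topology in
/-- In a trigonometric sum with nonnegative coefficients whose phases are given by an additive
function of the frequency, every coefficient is bounded by the supremum of the sum over `t ≥ 0`: the
mean value against the `j`-th exponential picks out all the terms with the `j`-th frequency, and
these have equal phases, so nothing cancels. -/
theorem coeff_le_of_norm_trigonometric_sum_le {ι : Type*} (s : Finset ι) (c : ι → ℝ)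
    (hc : ∀ i ∈ s, 0 ≤ c i) (μ : ι → ℝ) (f : ℝ →+ ℝ) {B : ℝ}
    (hB : ∀ t : ℝ, 0 ≤ t →
      ‖∑ i ∈ s, (c i : ℂ) * Complex.exp (Complex.I * (t * μ i - f (μ i)))‖ ≤ B)
    {j : ι} (hj : j ∈ s) : c j ≤ B := by
  classical
  -- frequencies seen from the `j`-th one
  let a : ι → ℝ := fun i => μ i - μ j
  let b : ι → ℂ := fun i => c i * Complex.exp (-(Complex.I * f (a i)))
  have hf : ∀ i, f (a i) = f (μ i) - f (μ j) := fun i => map_sub f _ _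
  have hG : ∀ t : ℝ, 0 ≤ t → ‖∑ i ∈ s, b i * Complex.exp (Complex.I * a i * t)‖ ≤ B := by
    intro t ht
    have : ∑ i ∈ s, b i * Complex.exp (Complex.I * a i * t) =
        Complex.exp (((-(t * μ j - f (μ j)) : ℝ) : ℂ) * Complex.I) *
          ∑ i ∈ s, (c i : ℂ) * Complex.exp (Complex.I * (t * μ i - f (μ i))) := by
      rw [Finset.mul_sum]
      refine Finset.sum_congr rfl fun i _ => ?_
      simp only [b, hf, a]
      rw [mul_assoc, ← Complex.exp_add, mul_left_comm, ← Complex.exp_add]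
      push_cast
      congr 2
      ring
    rw [this, norm_mul, Complex.norm_exp_ofReal_mul_I, one_mul]
    exact hB t ht
  have hlim : Tendsto (fun T : ℝ => (T : ℂ)⁻¹ * ∫ t in (0 : ℝ)..T,
      ∑ i ∈ s, b i * Complex.exp (Complex.I * a i * t)) atTop
      (𝓝 (∑ i ∈ s, if a i = 0 then (c i : ℂ) else 0)) := by
    have h : ∀ T : ℝ, (T : ℂ)⁻¹ * ∫ t in (0 : ℝ)..T,
        ∑ i ∈ s, b i * Complex.exp (Complex.I * a i * t) =
        ∑ i ∈ s, b i * ((T : ℂ)⁻¹ * ∫ t in (0 : ℝ)..T, Complex.exp (Complex.I * a i * t)) := by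
      intro T
      rw [intervalIntegral.integral_finsetSum
        fun i _ => (by fun_prop : Continuous _).intervalIntegrable _ _, Finset.mul_sum]
      refine Finset.sum_congr rfl fun i _ => ?_
      rw [intervalIntegral.integral_const_mul]
      ring
    simp_rw [h]
    refine tendsto_finsetSum _ fun i _ => ?_
    split_ifs with hi
    · refine tendsto_const_nhds.congr' ?_
      filter_upwards [eventually_gt_atTop 0] with T hT
      have : (T : ℂ) ≠ 0 := by exact_mod_cast hT.ne'
      simp [b, hi, this]
    · simpa using (tendsto_mean_exp hi).const_mul (b i)
  have hle : ‖∑ i ∈ s, if a i = 0 then (c i : ℂ) else 0‖ ≤ B := by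
    refine le_of_tendsto hlim.norm ?_
    filter_upwards [eventually_gt_atTop 0] with T hT
    rw [norm_mul, norm_inv, Complex.norm_real, Real.norm_of_nonneg hT.le]
    have := intervalIntegral.norm_integral_le_of_norm_le_const (a := 0) (b := T)
      (f := fun t : ℝ => ∑ i ∈ s, b i * Complex.exp (Complex.I * a i * t)) (C := B)
      fun t ht => hG t (by rw [Set.uIoc_of_le hT.le] at ht; exact ht.1.le)
    rw [sub_zero, abs_of_pos hT] at this
    rw [inv_mul_le_iff₀ hT, mul_comm]
    exact this
  have hre : (∑ i ∈ s, if a i = 0 then (c i : ℂ) else 0) =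
      ((∑ i ∈ s, if a i = 0 then c i else 0 : ℝ) : ℂ) := by
    push_cast
    exact Finset.sum_congr rfl fun i _ => by split_ifs <;> simp
  rw [hre, Complex.norm_real] at hle
  refine le_trans ?_ ((Real.le_norm_self _).trans hle)
  have := Finset.single_le_sum (f := fun i => if a i = 0 then c i else 0)
    (fun i hi => by split_ifs; exacts [hc i hi, le_rfl]) hj
  simpa [a] using this

theorem card_piAntidiag_le {ι : Type*} [DecidableEq ι] (s : Finset ι) (k : ℕ) :
    (s.piAntidiag k).card ≤ (k + 1) ^ s.card := by
  calc (s.piAntidiag k).card ≤ (Fintype.piFinset fun _ : s => Finset.range (k + 1)).card := by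
        refine Finset.card_le_card_of_injOn (fun κ i => κ i) (fun κ hκ => ?_) ?_
        · obtain ⟨h1, -⟩ := Finset.mem_piAntidiag.1 hκ
          simp only [Finset.mem_coe, Fintype.mem_piFinset, Finset.mem_range]
          intro i
          have := Finset.single_le_sum (f := κ) (fun _ _ => Nat.zero_le _) i.2
          exact Nat.lt_succ_of_le (this.trans_eq h1)
        · intro κ hκ κ' hκ' h
          ext i
          by_cases hi : i ∈ s
          · exact congrFun h ⟨i, hi⟩
          · have h1 := (Finset.mem_piAntidiag.1 hκ).2 i
            have h2 := (Finset.mem_piAntidiag.1 hκ').2 i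
            rw [not_imp_comm.1 h1 hi, not_imp_comm.1 h2 hi]
    _ = (k + 1) ^ s.card := by simp

/-- Kronecker's approximation theorem, stated for additive maps: on a finite set of frequencies the
characters `x ↦ exp (i t x)` with `t ≥ 0` approximate every character of the form `exp (i f x)`. No
independence of the frequencies is required, as an additive `f` respects all integer relations. The
proof is Bohr's: otherwise the sum of `exp (i (t x - f x))` over the frequencies is bounded away
from their number, and the coefficients of its `k`-th power are too small for large `k`. -/
theorem exists_time_approximating_character (S : Finset ℝ) (f : ℝ →+ ℝ) {ε : ℝ} (hε : 0 < ε) :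
    ∃ t : ℝ, 0 ≤ t ∧ ∀ x ∈ S,
      ‖Complex.exp (Complex.I * (t * x)) - Complex.exp (Complex.I * f x)‖ < ε := by
  classical
  by_contra! hcon
  -- the frequency `0` fixes the common phase of all the terms
  let R := insert 0 S
  let F : ℝ → ℂ := fun t => ∑ x ∈ R, Complex.exp (Complex.I * (t * x - f x))
  have hunit : ∀ t x : ℝ, ‖Complex.exp (Complex.I * (t * x - f x))‖ = 1 := fun t x => by
    rw [mul_comm, show (t * x - f x : ℂ) = ((t * x - f x : ℝ) : ℂ) by push_cast; ring,
      Complex.norm_exp_ofReal_mul_I]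
  have hF : ∀ t, 0 ≤ t → ‖F t‖ ≤ R.card - ε ^ 2 / 4 := by
    intro t ht
    obtain ⟨x, hxS, hx⟩ := hcon t ht
    have hx0 : x ≠ 0 := by
      rintro rfl
      simp at hx
      linarith
    have hx' : ε ≤ ‖(1 : ℂ) - Complex.exp (Complex.I * (t * x - f x))‖ := by
      rw [norm_sub_rev]
      refine hx.trans_eq ?_
      rw [mul_sub, Complex.exp_sub, ← one_mul ‖_ / _ - 1‖,
        ← (show ‖Complex.exp (Complex.I * f x)‖ = 1 by
            rw [mul_comm, Complex.norm_exp_ofReal_mul_I]), ← norm_mul, mul_sub,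
        mul_div_cancel₀ _ (Complex.exp_ne_zero _), mul_one]
    have h2 := norm_add_le_of_le_norm_sub norm_one (hunit t x) hε.le hx'
    have h0R : (0 : ℝ) ∈ R := Finset.mem_insert_self _ _
    have hxR : x ∈ R.erase 0 := Finset.mem_erase.2 ⟨hx0, Finset.mem_insert_of_mem hxS⟩
    have hsum : F t = (1 + Complex.exp (Complex.I * (t * x - f x))) +
        ∑ y ∈ (R.erase 0).erase x, Complex.exp (Complex.I * (t * y - f y)) := by
      simp only [F]
      rw [← Finset.add_sum_erase _ _ h0R, ← Finset.add_sum_erase _ _ hxR]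
      simp [add_assoc]
    have h3 : ‖∑ y ∈ (R.erase 0).erase x, Complex.exp (Complex.I * (t * y - f y))‖ ≤
        ((R.erase 0).erase x).card := by
      refine (norm_sum_le _ _).trans ?_
      simp [hunit]
    have hcard : (((R.erase 0).erase x).card : ℝ) + 2 = R.card := by
      have h1 := Finset.card_erase_add_one hxR
      have h2 := Finset.card_erase_add_one h0R
      rw [← h2, ← h1]; push_cast; ring
    rw [hsum]
    refine (norm_add_le _ _).trans ?_
    linarith
  set N : ℝ := (R.card : ℝ) with hN
  set B : ℝ := N - ε ^ 2 / 4 with hB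
  have hB0 : 0 ≤ B := (norm_nonneg _).trans (hF 0 le_rfl)
  have hN0 : 0 < N := by positivity
  have hkey : ∀ k : ℕ, N ^ k ≤ (k + 1) ^ R.card * B ^ k := by
    intro k
    have hpow : ∀ t : ℝ, F t ^ k = ∑ κ ∈ R.piAntidiag k, ((Nat.multinomial R κ : ℝ) : ℂ) *
        Complex.exp (Complex.I * (t * (∑ x ∈ R, κ x * x : ℝ) - f (∑ x ∈ R, κ x * x))) := by
      intro t
      simp only [F]
      rw [Finset.sum_pow_eq_sum_piAntidiag]
      refine Finset.sum_congr rfl fun κ _ => ?_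
      rw [Complex.ofReal_natCast]
      congr 1
      simp_rw [← Complex.exp_nat_mul]
      rw [← Complex.exp_sum]
      congr 1
      have hfs : f (∑ x ∈ R, κ x * x) = ∑ x ∈ R, κ x * f x := by
        rw [map_sum]
        refine Finset.sum_congr rfl fun x _ => ?_
        rw [← nsmul_eq_mul, map_nsmul, nsmul_eq_mul]
      rw [hfs]
      push_cast
      rw [Finset.mul_sum, ← Finset.sum_sub_distrib, Finset.mul_sum]
      exact Finset.sum_congr rfl fun x _ => by ring
    have hone : ∀ κ ∈ R.piAntidiag k, (Nat.multinomial R κ : ℝ) ≤ B ^ k := by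
      intro κ hκ
      refine coeff_le_of_norm_trigonometric_sum_le (R.piAntidiag k)
        (fun κ => (Nat.multinomial R κ : ℝ))
        (fun _ _ => Nat.cast_nonneg _) (fun κ => ∑ x ∈ R, κ x * x) f
        (fun t ht => ?_) hκ
      rw [← hpow, norm_pow]
      exact pow_le_pow_left₀ (norm_nonneg _) (hF t ht) k
    calc N ^ k = (∑ x ∈ R, (1 : ℝ)) ^ k := by simp [hN]
      _ = ∑ κ ∈ R.piAntidiag k, (Nat.multinomial R κ : ℝ) := by
        rw [Finset.sum_pow_eq_sum_piAntidiag]; simp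
      _ ≤ ∑ κ ∈ R.piAntidiag k, B ^ k := Finset.sum_le_sum hone
      _ = (R.piAntidiag k).card * B ^ k := by simp
      _ ≤ (k + 1) ^ R.card * B ^ k := by
        gcongr
        exact_mod_cast card_piAntidiag_le R k
  -- the exponential growth of `(N / B) ^ k` beats the polynomial `(k + 1) ^ |R|`
  have hlim : Filter.Tendsto (fun k : ℕ => ((k : ℝ) + 1) ^ R.card * (B / N) ^ k) Filter.atTop
      (nhds 0) := by
    have hr : B / N < 1 := by
      rw [div_lt_one hN0, hB]
      have : 0 < ε ^ 2 := by positivity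
      linarith
    rcases hB0.eq_or_lt with h0 | h0
    · refine tendsto_const_nhds.congr' ?_
      filter_upwards [Filter.eventually_ne_atTop 0] with k hk
      simp [← h0, hk]
    · have h := ((tendsto_pow_const_mul_const_pow_of_lt_one R.card (by positivity) hr).comp
        (Filter.tendsto_add_atTop_nat 1)).const_mul (B / N)⁻¹
      rw [mul_zero] at h
      refine h.congr fun k => ?_
      have : B / N ≠ 0 := by positivity
      simp only [Function.comp_apply, Nat.cast_add, Nat.cast_one, pow_succ]
      field_simp
  obtain ⟨k, hk⟩ := (hlim.eventually (gt_mem_nhds (one_pos (α := ℝ)))).exists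
  have := hkey k
  rw [div_pow, ← mul_div_assoc, div_lt_one (by positivity)] at hk
  linarith

/-! ### Limits of the quantum walk -/

theorem quantumWalk_eq_conj_diagonal {V : Type*} [Fintype V] [DecidableEq V] {A : Matrix V V ℝ}
    (hA : (A.map (fun a : ℝ => (a : ℂ))).IsHermitian) (t : ℝ) :
    quantumWalk A t = (hA.eigenvectorUnitary : Matrix V V ℂ) *
      Matrix.diagonal (fun i => Complex.exp (Complex.I * (t * hA.eigenvalues i))) *
      star (hA.eigenvectorUnitary : Matrix V V ℂ) := by
  set U := (hA.eigenvectorUnitary : Matrix V V ℂ) with hU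
  have hUU : U * star U = 1 := Unitary.coe_mul_star_self _
  have hinv : U⁻¹ = star U := Matrix.inv_eq_right_inv hUU
  have hunit : IsUnit U := IsUnit.of_mul_eq_one _ hUU
  have h : (Complex.I * (t : ℂ)) • A.map (fun a : ℝ => (a : ℂ)) =
      U * Matrix.diagonal (fun i => Complex.I * (t * hA.eigenvalues i)) * U⁻¹ := by
    conv_lhs => rw [hA.spectral_theorem]
    rw [Unitary.conjStarAlgAut_apply, ← smul_mul_assoc, ← mul_smul_comm, hinv,
      ← Matrix.diagonal_smul]
    congr 3
    ext i
    simp [mul_assoc]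
  rw [quantumWalk, h, Matrix.exp_conj _ _ hunit, Matrix.exp_diagonal, hinv]
  congr 3
  ext i
  rw [Pi.coe_exp, Complex.exp_eq_exp_ℂ]

/-- For every additive `f` the closure of the quantum walk of a symmetric matrix contains the
unitary matrix that acts as `exp (i f μ)` on the eigenvectors of eigenvalue `μ`. -/
theorem exists_unitary_mem_closure_quantumWalk {V : Type*} [Fintype V] [DecidableEq V]
    {A : Matrix V V ℝ} (hA : (A.map (fun a : ℝ => (a : ℂ))).IsHermitian) (f : ℝ →+ ℝ) :
    ∃ Z ∈ Matrix.unitaryGroup V ℂ, Z ∈ closure {B | ∃ t : ℝ, 0 ≤ t ∧ B = quantumWalk A t} ∧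
      ∀ (i : V) (w : V → ℂ), A.map (fun a : ℝ => (a : ℂ)) *ᵥ w = (hA.eigenvalues i : ℂ) • w →
        Z *ᵥ w = Complex.exp (Complex.I * f (hA.eigenvalues i)) • w := by
  set U := (hA.eigenvectorUnitary : Matrix V V ℂ) with hU
  have hUU : U * star U = 1 := Unitary.coe_mul_star_self _
  have hUU' : star U * U = 1 := Unitary.coe_star_mul_self _
  have key : ∀ k : ℕ, ∃ t : ℝ, 0 ≤ t ∧ ∀ i,
      ‖Complex.exp (Complex.I * (t * hA.eigenvalues i)) -
        Complex.exp (Complex.I * f (hA.eigenvalues i))‖ < 1 / ((k : ℝ) + 1) := by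
    intro k
    obtain ⟨t, ht, h⟩ := exists_time_approximating_character
      (Finset.univ.image hA.eigenvalues) f (Nat.one_div_pos_of_nat (n := k) (α := ℝ))
    exact ⟨t, ht, fun i => h _ (Finset.mem_image_of_mem _ (Finset.mem_univ i))⟩
  choose t ht hlt using key
  let z : V → ℂ := fun i => Complex.exp (Complex.I * f (hA.eigenvalues i))
  have hzz : ∀ i, z i * star (z i) = 1 := fun i => by
    have : ‖z i‖ = 1 := by
      simp only [z]; rw [mul_comm, Complex.norm_exp_ofReal_mul_I]
    rw [Complex.star_def, Complex.mul_conj, Complex.normSq_eq_norm_sq, this]; simp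
  refine ⟨U * Matrix.diagonal z * star U, ?_, ?_, ?_⟩
  · rw [Matrix.mem_unitaryGroup_iff]
    have hd : Matrix.diagonal z * star (Matrix.diagonal z) = 1 := by
      rw [Matrix.star_eq_conjTranspose, Matrix.diagonal_conjTranspose, Matrix.diagonal_mul_diagonal,
        ← Matrix.diagonal_one]
      congr 1
      ext i
      exact hzz i
    calc U * Matrix.diagonal z * star U * star (U * Matrix.diagonal z * star U)
        = U * (Matrix.diagonal z * ((star U * U) * star (Matrix.diagonal z))) * star U := by
          simp only [star_mul, star_star, mul_assoc]
      _ = 1 := by rw [hUU', one_mul, hd, mul_one, hUU]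
  · refine mem_closure_of_tendsto (f := fun k => quantumWalk A (t k)) (b := Filter.atTop) ?_
      (Filter.Eventually.of_forall fun k => ⟨t k, ht k, rfl⟩)
    simp_rw [quantumWalk_eq_conj_diagonal hA]
    have hlim : Filter.Tendsto (fun k : ℕ => fun i : V =>
        Complex.exp (Complex.I * (t k * hA.eigenvalues i))) Filter.atTop (nhds z) := by
      rw [tendsto_pi_nhds]
      intro i
      rw [tendsto_iff_norm_sub_tendsto_zero]
      exact squeeze_zero (fun _ => norm_nonneg _) (fun k => (hlt k i).le)
        tendsto_one_div_add_atTop_nhds_zero_nat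
    have hc : Continuous fun y : V → ℂ => U * Matrix.diagonal y * star U := by fun_prop
    exact (hc.tendsto z).comp hlim
  · intro i w hw
    have h1 : ∀ j, (hA.eigenvalues j : ℂ) * (star U *ᵥ w) j =
        (hA.eigenvalues i : ℂ) * (star U *ᵥ w) j := by
      have h : star U *ᵥ _ = star U *ᵥ _ := congrArg (star U *ᵥ ·) hw
      conv_lhs at h => rw [hA.spectral_theorem]
      rw [Unitary.conjStarAlgAut_apply, ← hU, Matrix.mulVec_mulVec, ← mul_assoc, ← mul_assoc, hUU',
        one_mul, ← Matrix.mulVec_mulVec, Matrix.mulVec_smul] at h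
      intro j
      simpa [Matrix.mulVec_diagonal] using congrFun h j
    have h2 : Matrix.diagonal z *ᵥ (star U *ᵥ w) = z i • (star U *ᵥ w) := by
      ext j
      rw [Matrix.mulVec_diagonal, Pi.smul_apply, smul_eq_mul]
      rcases eq_or_ne ((star U *ᵥ w) j) 0 with h0 | h0
      · rw [h0, mul_zero, mul_zero]
      · have := Complex.ofReal_injective (mul_right_cancel₀ h0 (h1 j))
        simp only [z, this]
    rw [← Matrix.mulVec_mulVec, ← Matrix.mulVec_mulVec, h2, Matrix.mulVec_smul,
      Matrix.mulVec_mulVec, hUU, Matrix.one_mulVec]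

/-! ### Krylov spaces and rank-one perturbations -/

open Polynomial in
/-- The linear map `g ↦ g(M) u` from polynomials to vectors. -/
noncomputable def krylovMap {V : Type*} [Fintype V] [DecidableEq V] (M : Matrix V V ℂ)
    (u : V → ℂ) : ℂ[X] →ₗ[ℂ] (V → ℂ) where
  toFun g := aeval M g *ᵥ u
  map_add' g h := by rw [map_add, Matrix.add_mulVec]
  map_smul' c g := by rw [map_smul, Matrix.smul_mulVec, RingHom.id_apply]

/-- The Krylov space of `u` under `M`: all vectors `g(M) u` with `g` a polynomial. -/
noncomputable def krylov {V : Type*} [Fintype V] [DecidableEq V] (M : Matrix V V ℂ)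
    (u : V → ℂ) : Submodule ℂ (V → ℂ) :=
  LinearMap.range (krylovMap M u)

section Krylov

open Polynomial

variable {V : Type*} [Fintype V] [DecidableEq V] {M : Matrix V V ℂ} {u : V → ℂ}

theorem krylovMap_apply (g : ℂ[X]) : krylovMap M u g = aeval M g *ᵥ u := rfl

theorem krylovMap_mul (g h : ℂ[X]) :
    krylovMap M u (g * h) = aeval M g *ᵥ krylovMap M u h := by
  rw [krylovMap_apply, krylovMap_apply, map_mul, Matrix.mulVec_mulVec]

theorem self_mem_krylov : u ∈ krylov M u := ⟨1, by simp [krylovMap_apply]⟩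

theorem mulVec_mem_krylov {w : V → ℂ} (hw : w ∈ krylov M u) : M *ᵥ w ∈ krylov M u := by
  obtain ⟨g, rfl⟩ := hw
  exact ⟨X * g, by rw [krylovMap_mul, aeval_X]⟩

theorem krylov_le {N : Submodule ℂ (V → ℂ)} (hu : u ∈ N) (hM : ∀ w ∈ N, M *ᵥ w ∈ N) :
    krylov M u ≤ N := by
  rintro _ ⟨g, rfl⟩
  induction g using Polynomial.induction_on with
  | C a => simpa [krylovMap_apply, Algebra.algebraMap_eq_smul_one, Matrix.smul_mulVec] using
      N.smul_mem a hu
  | add p q hp hq => rw [map_add]; exact N.add_mem hp hq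
  | monomial n a h =>
    rw [pow_succ', mul_left_comm, krylovMap_mul, aeval_X]
    exact hM _ h

theorem exists_monic_krylovMap_eq_zero_iff (M : Matrix V V ℂ) (u : V → ℂ) :
    ∃ p : ℂ[X], p.Monic ∧ ∀ g, krylovMap M u g = 0 ↔ p ∣ g := by
  let I : Ideal ℂ[X] :=
    { carrier := {g | krylovMap M u g = 0}
      add_mem' := fun {a b} ha hb => by
        rw [Set.mem_ofPred_eq] at *; rw [map_add, ha, hb, add_zero]
      zero_mem' := map_zero _
      smul_mem' := fun c x hx => by
        rw [Set.mem_ofPred_eq] at *; rw [smul_eq_mul, krylovMap_mul, hx, Matrix.mulVec_zero] }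
  have hI : ∀ g, krylovMap M u g = 0 ↔ Submodule.IsPrincipal.generator I ∣ g := fun g => by
    rw [← Submodule.IsPrincipal.mem_iff_generator_dvd]; rfl
  have h0 : Submodule.IsPrincipal.generator I ≠ 0 := by
    intro h
    have := (hI M.charpoly).1 (by rw [krylovMap_apply, Matrix.aeval_self_charpoly,
      Matrix.zero_mulVec])
    rw [h, zero_dvd_iff] at this
    exact M.charpoly_monic.ne_zero this
  refine ⟨normalize (Submodule.IsPrincipal.generator I), Polynomial.monic_normalize h0, fun g => ?_⟩
  rw [hI, normalize_dvd_iff]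

theorem natDegree_le_finrank_krylov {p : ℂ[X]} (hp : p.Monic)
    (hpk : ∀ g, krylovMap M u g = 0 ↔ p ∣ g) :
    p.natDegree ≤ Module.finrank ℂ (krylov M u) := by
  let φ : degreeLT ℂ p.natDegree →ₗ[ℂ] krylov M u :=
    (krylovMap M u).rangeRestrict ∘ₗ (degreeLT ℂ p.natDegree).subtype
  have hφ : Function.Injective φ := by
    rw [← LinearMap.ker_eq_bot, LinearMap.ker_eq_bot']
    intro g hg
    have h : krylovMap M u g = 0 := congrArg Subtype.val hg
    have hlt := mem_degreeLT.1 g.2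
    rw [hpk] at h
    refine Subtype.ext (eq_zero_of_dvd_of_degree_lt h ?_)
    rwa [degree_eq_natDegree hp.ne_zero]
  have := LinearMap.finrank_le_finrank_of_injective hφ
  rwa [(degreeLTEquiv ℂ p.natDegree).finrank_eq, Module.finrank_fin_fun] at this

open scoped ComplexOrder in
/-- An eigenvector of a Hermitian matrix that is orthogonal to `u` is orthogonal to the whole Krylov
space of `u`, so the only such vector inside the Krylov space is zero. -/
theorem eq_zero_of_mem_krylov_of_orthogonal (hM : M.IsHermitian) {w : V → ℂ}
    (hw : w ∈ krylov M u) {μ : ℂ} (hμ : M *ᵥ w = μ • w) (h : star w ⬝ᵥ u = 0) : w = 0 := by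
  have key : krylov M u ≤ LinearMap.ker (dotProductBilin ℂ ℂ (star w)) := by
    refine krylov_le h fun y hy => ?_
    rw [LinearMap.mem_ker] at hy ⊢
    change star w ⬝ᵥ y = 0 at hy
    change star w ⬝ᵥ (M *ᵥ y) = 0
    rw [Matrix.dotProduct_mulVec, ← hM.eq, ← Matrix.star_mulVec, hμ, star_smul, smul_dotProduct, hy,
      smul_zero]
  exact dotProduct_star_self_eq_zero.1 (key hw)

/-- The difference quotient `(p(μ) - p(X)) / (μ - X)`, written out so that its dependence on `μ` is
visibly polynomial. -/
noncomputable def diffQuot (p : ℂ[X]) (μ : ℂ) : ℂ[X] :=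
  ∑ i ∈ Finset.range (p.natDegree + 1), C (p.coeff i) *
    ∑ j ∈ Finset.range i, C μ ^ j * X ^ (i - 1 - j)

theorem diffQuot_mul (p : ℂ[X]) (μ : ℂ) : diffQuot p μ * (C μ - X) = C (p.eval μ) - p := by
  have h : ∀ i ∈ Finset.range (p.natDegree + 1), C (p.coeff i) *
      (∑ j ∈ Finset.range i, C μ ^ j * X ^ (i - 1 - j)) * (C μ - X) =
      C (p.coeff i * μ ^ i) - C (p.coeff i) * X ^ i := fun i _ => by
    rw [mul_assoc, (Commute.all (C μ) X).geom_sum₂_mul, mul_sub, C_mul, C_pow]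
  rw [diffQuot, Finset.sum_mul, Finset.sum_congr rfl h, Finset.sum_sub_distrib, ← map_sum,
    ← eval_eq_sum_range, ← as_sum_range_C_mul_X_pow]

/-- The polynomial in `μ` that is the `v`-th coordinate of `((p(μ) - p(M)) / (μ - M)) u`. If
`p(M) u = 0`, this is `p` times the resolvent function `((μ - M)⁻¹ u) v`. -/
noncomputable def krylovNumerator (M : Matrix V V ℂ) (u : V → ℂ) (v : V) (p : ℂ[X]) : ℂ[X] :=
  ∑ i ∈ Finset.range (p.natDegree + 1), C (p.coeff i) *
    ∑ j ∈ Finset.range i, C ((M ^ (i - 1 - j) *ᵥ u) v) * X ^ j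

theorem eval_krylovNumerator (v : V) (p : ℂ[X]) (μ : ℂ) :
    (krylovNumerator M u v p).eval μ = krylovMap M u (diffQuot p μ) v := by
  simp only [krylovNumerator, diffQuot, eval_finsetSum, eval_mul, eval_C, eval_pow, eval_X,
    map_sum, Finset.sum_apply]
  refine Finset.sum_congr rfl fun i _ => ?_
  rw [← smul_eq_C_mul, map_smul, map_sum, Pi.smul_apply, Finset.sum_apply, smul_eq_mul]
  congr 1
  refine Finset.sum_congr rfl fun j _ => ?_
  rw [← C_pow, ← smul_eq_C_mul, map_smul, krylovMap_apply, aeval_X_pow, Pi.smul_apply, smul_eq_mul,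
    mul_comm]

theorem coeff_krylovNumerator (v : V) (p : ℂ[X]) (k : ℕ) :
    (krylovNumerator M u v p).coeff k = ∑ i ∈ Finset.range (p.natDegree + 1),
      p.coeff i * if k < i then (M ^ (i - 1 - k) *ᵥ u) v else 0 := by
  simp [krylovNumerator, finsetSum_coeff, coeff_X_pow]

theorem krylovNumerator_monic {v : V} (hv : u v = 1) {p : ℂ[X]} (hp : p.Monic)
    (h0 : p.natDegree ≠ 0) : (krylovNumerator M u v p).Monic ∧
      (krylovNumerator M u v p).natDegree + 1 = p.natDegree := by
  have h1 : (krylovNumerator M u v p).natDegree ≤ p.natDegree - 1 := by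
    rw [natDegree_le_iff_coeff_eq_zero]
    intro k hk
    rw [coeff_krylovNumerator]
    refine Finset.sum_eq_zero fun i hi => ?_
    rw [Finset.mem_range] at hi
    rw [if_neg (by omega), mul_zero]
  have h2 : (krylovNumerator M u v p).coeff (p.natDegree - 1) = 1 := by
    rw [coeff_krylovNumerator, Finset.sum_eq_single p.natDegree]
    · rw [if_pos (by omega), hp.coeff_natDegree]
      simp [hv]
    · intro i hi hne
      rw [Finset.mem_range] at hi
      rw [if_neg (by omega), mul_zero]
    · intro h; simp at h
  refine ⟨monic_of_natDegree_le_of_coeff_eq_one _ h1 h2, ?_⟩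
  have := le_natDegree_of_ne_zero (h2.trans_ne one_ne_zero)
  omega

/-- At a common root `μ`, the vector `((p(μ) - p(M)) / (μ - M)) u` would be an eigenvector of `M` in
the Krylov space with vanishing `v`-th coordinate, hence zero, although the degree of its polynomial
is less than that of `p`. -/
theorem isCoprime_krylovNumerator (hM : M.IsHermitian) {v : V}
    (horth : ∀ w ∈ krylov M u, w v = 0 → star w ⬝ᵥ u = 0) {p : ℂ[X]} (hp : p.Monic)
    (hpk : ∀ g, krylovMap M u g = 0 ↔ p ∣ g) : IsCoprime p (krylovNumerator M u v p) := by
  rw [isCoprime_iff_aeval_ne_zero_of_isAlgClosed ℂ ℂ]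
  intro μ
  by_contra! hcon
  simp only [coe_aeval_eq_eval] at hcon
  obtain ⟨h1, h2⟩ := hcon
  rw [eval_krylovNumerator] at h2
  have hdq := diffQuot_mul p μ
  rw [h1, C_0, zero_sub] at hdq
  have hne : diffQuot p μ ≠ 0 := by
    intro h
    rw [h, zero_mul, eq_comm, neg_eq_zero] at hdq
    exact hp.ne_zero hdq
  have hzero : krylovMap M u (diffQuot p μ) = 0 := by
    refine eq_zero_of_mem_krylov_of_orthogonal hM ⟨_, rfl⟩ (μ := μ) ?_ (horth _ ⟨_, rfl⟩ h2)
    have h := (hpk (-p)).2 (by simp)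
    rw [← hdq, mul_comm, krylovMap_mul, map_sub, aeval_C, aeval_X, Matrix.sub_mulVec,
      Algebra.algebraMap_eq_smul_one, Matrix.smul_mulVec, Matrix.one_mulVec, sub_eq_zero] at h
    exact h.symm
  have hdvd := (hpk _).1 hzero
  have h3 : C μ - X ≠ (0 : ℂ[X]) := by
    rw [sub_ne_zero]; exact (X_ne_C μ).symm
  have h4 := congrArg natDegree hdq
  rw [natDegree_mul hne h3, natDegree_neg, ← neg_sub, natDegree_neg, natDegree_X_sub_C] at h4
  have := natDegree_le_of_dvd hdvd hne
  omega

/-- The secular equation of the perturbation `M + τ D`, where `D` acts on the Krylov space of `u`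
with rank one. -/
theorem eval_eq_of_eigenvector (hM : M.IsHermitian) {D : Matrix V V ℂ} {v : V}
    (hD : ∀ w ∈ krylov M u, D *ᵥ w = w v • u)
    (horth : ∀ w ∈ krylov M u, w v = 0 → star w ⬝ᵥ u = 0) {p : ℂ[X]}
    (hpk : ∀ g, krylovMap M u g = 0 ↔ p ∣ g) {τ μ : ℂ} {w : V → ℂ} (hw : w ∈ krylov M u)
    (hw0 : w ≠ 0) (hμ : (M + τ • D) *ᵥ w = μ • w) :
    p.eval μ = τ * (krylovNumerator M u v p).eval μ := by
  rw [Matrix.add_mulVec, Matrix.smul_mulVec, hD w hw] at hμ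
  have hv : w v ≠ 0 := by
    intro h
    rw [h, zero_smul, smul_zero, add_zero] at hμ
    exact hw0 (eq_zero_of_mem_krylov_of_orthogonal hM hw hμ (horth w hw h))
  obtain ⟨g, rfl⟩ := hw
  have hpw : aeval M p *ᵥ krylovMap M u g = 0 := by
    rw [← krylovMap_mul, hpk]; exact dvd_mul_right _ _
  have h1 : aeval M (diffQuot p μ) *ᵥ (τ • krylovMap M u g v • u) =
      p.eval μ • krylovMap M u g := by
    rw [← eq_sub_iff_add_eq'] at hμ
    have h : aeval M (C μ - X) *ᵥ krylovMap M u g = μ • krylovMap M u g - M *ᵥ krylovMap M u g := by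
      rw [map_sub, aeval_C, aeval_X, Matrix.sub_mulVec, Algebra.algebraMap_eq_smul_one,
        Matrix.smul_mulVec, Matrix.one_mulVec]
    rw [hμ, ← h, Matrix.mulVec_mulVec, ← map_mul, diffQuot_mul, map_sub, Matrix.sub_mulVec, hpw,
      sub_zero, aeval_C, Algebra.algebraMap_eq_smul_one, Matrix.smul_mulVec, Matrix.one_mulVec]
  rw [Matrix.mulVec_smul, Matrix.mulVec_smul] at h1
  have h2 := congrFun h1 v
  simp only [Pi.smul_apply, smul_eq_mul] at h2
  rw [← krylovMap_apply, ← eval_krylovNumerator] at h2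
  exact mul_right_cancel₀ hv (by rw [← h2]; ring)

theorem krylovNumerator_mem_lifts {F : Type*} [Field F] [Algebra F ℂ] (v : V) {p : ℂ[X]}
    (hp : p ∈ lifts (algebraMap F ℂ))
    (hM : ∀ k, (M ^ k *ᵥ u) v ∈ (algebraMap F ℂ).range) :
    krylovNumerator M u v p ∈ lifts (algebraMap F ℂ) := by
  refine sum_mem fun i _ => mul_mem ?_ (sum_mem fun j _ => mul_mem ?_ ?_)
  · exact C'_mem_lifts ((lifts_iff_coeff_lifts p).1 hp i)
  · exact C'_mem_lifts (hM _)
  · exact pow_mem (X_mem_lifts _) _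

end Krylov

/-! ### Eigenvectors and orbit vectors -/

theorem iSup_eigenspace_toLin'_eq_top {V : Type*} [Fintype V] [DecidableEq V] {A : Matrix V V ℂ}
    (hA : A.IsHermitian) : ⨆ μ, Module.End.eigenspace A.toLin' μ = ⊤ := by
  refine eq_top_iff.2 fun w _ => ?_
  have hw : w = (hA.eigenvectorUnitary : Matrix V V ℂ) *ᵥ
      (star (hA.eigenvectorUnitary : Matrix V V ℂ) *ᵥ w) := by
    rw [Matrix.mulVec_mulVec, show _ * star _ = (1 : Matrix V V ℂ) from
      Unitary.coe_mul_star_self hA.eigenvectorUnitary, Matrix.one_mulVec]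
  rw [hw, Matrix.mulVec_eq_sum]
  refine Submodule.sum_mem _ fun i _ => ?_
  rw [op_smul_eq_smul]
  refine Submodule.smul_mem _ _ (Submodule.mem_iSup_of_mem (hA.eigenvalues i : ℂ) ?_)
  rw [Module.End.mem_eigenspace_iff, Matrix.toLin'_apply, hA.eigenvectorUnitary_transpose_apply,
    hA.mulVec_eigenvectorBasis]
  rfl

theorem exists_eigenvalues_eq {V : Type*} [Fintype V] [DecidableEq V] {A : Matrix V V ℂ}
    (hA : A.IsHermitian) {w : V → ℂ} (hw : w ≠ 0) {μ : ℂ} (h : A *ᵥ w = μ • w) :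
    ∃ i, (hA.eigenvalues i : ℂ) = μ := by
  have hμ : Module.End.HasEigenvalue A.toLin' μ :=
    Module.End.hasEigenvalue_of_hasEigenvector
      ⟨Module.End.mem_eigenspace_iff.2 (by rwa [Matrix.toLin'_apply]), hw⟩
  have := hμ.mem_spectrum
  rw [Matrix.spectrum_toLin', hA.spectrum_eq_image_range] at this
  simpa using this

/-- An invariant subspace of a Hermitian matrix is spanned by the eigenvectors in it. -/
theorem le_of_forall_eigenvector {V : Type*} [Fintype V] [DecidableEq V] {A : Matrix V V ℂ}
    (hA : A.IsHermitian) {N N' : Submodule ℂ (V → ℂ)} (hN : ∀ w ∈ N, A *ᵥ w ∈ N)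
    (h : ∀ i, ∀ w ∈ N, w ≠ 0 → A *ᵥ w = (hA.eigenvalues i : ℂ) • w → w ∈ N') : N ≤ N' := by
  rw [Submodule.eq_iSup_inf_genEigenspace (p := N) (f := A.toLin') 1
    (fun w hw => by rw [Matrix.toLin'_apply]; exact hN w hw) (iSup_eigenspace_toLin'_eq_top hA)]
  refine iSup_le fun μ w hw => ?_
  rcases eq_or_ne w 0 with rfl | h0
  · exact zero_mem _
  have hw2 : A *ᵥ w = μ • w := by
    have := Module.End.mem_eigenspace_iff.1 hw.2
    rwa [Matrix.toLin'_apply] at this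
  obtain ⟨i, rfl⟩ := exists_eigenvalues_eq hA h0 hw2
  exact h i w hw.1 h0 hw2

/-- The vector with value `ω ^ j` at `σ^[j] v` for `j < r`, and `0` elsewhere, provided that these
points are distinct; values at coinciding points are added up. If `σ` is injective, `σ^[r] v = v`
and `ω ^ r = 1`, composition with `σ` multiplies it by `ω`. -/
noncomputable def orbitVector {V : Type*} [DecidableEq V] (σ : V → V) (v : V) (r : ℕ) (ω : ℂ) :
    V → ℂ :=
  fun x => ∑ j ∈ Finset.range r, if σ^[j] v = x then ω ^ j else 0

section OrbitVector

variable {V : Type*} [DecidableEq V] {σ : V → V} {v : V} {r : ℕ} {ω : ℂ}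

theorem orbitVector_comp (hσ : σ.Injective) (hr : σ^[r] v = v) (hω : ω ^ r = 1) (x : V) :
    orbitVector σ v r ω (σ x) = ω * orbitVector σ v r ω x := by
  let g : ℕ → ℂ := fun j => if σ^[j] v = σ x then ω ^ j else 0
  have h1 : ∑ j ∈ Finset.range r, g (j + 1) = ∑ j ∈ Finset.range r, g j := by
    have := (Finset.sum_range_succ g r).symm.trans (Finset.sum_range_succ' g r)
    have h0 : g r = g 0 := by simp [g, hr, hω]
    rw [h0] at this
    exact (add_right_cancel this).symm
  rw [orbitVector, orbitVector, Finset.mul_sum, ← show _ = ∑ j ∈ Finset.range r, g j from h1]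
  refine Finset.sum_congr rfl fun j _ => ?_
  simp only [g, Function.iterate_succ_apply', hσ.eq_iff, mul_ite, mul_zero, pow_succ']

theorem orbitVector_self (hr : 0 < r)
    (hinj : Set.InjOn (fun j => σ^[j] v) (Finset.range r : Set ℕ)) :
    orbitVector σ v r ω v = 1 := by
  rw [orbitVector, Finset.sum_eq_single_of_mem 0 (Finset.mem_range.2 hr)]
  · simp
  · intro j hj h0
    exact if_neg fun h => h0 (hinj hj (by simpa using hr) h)

theorem orbitVector_eq_zero {x : V} (hx : ∀ j < r, σ^[j] v ≠ x) : orbitVector σ v r ω x = 0 :=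
  Finset.sum_eq_zero fun j hj => if_neg (hx j (Finset.mem_range.1 hj))

omit [DecidableEq V] in
theorem apply_iterate_of_apply_comp {w : V → ℂ} (hw : ∀ x, w (σ x) = ω * w x) (j : ℕ) (x : V) :
    w (σ^[j] x) = ω ^ j * w x := by
  induction j with
  | zero => simp
  | succ j ih => rw [Function.iterate_succ_apply', hw, ih, pow_succ', mul_assoc]

/-- Fourier inversion on the orbit. The exponent `r - i` stands for `-i`, which is legitimate as
`ζ ^ r = 1`. -/
theorem sum_orbitVector {ζ : ℂ} (hζ : IsPrimitiveRoot ζ r) {i : ℕ} (hi : i < r) :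
    ∑ k ∈ Finset.range r, (ζ ^ k) ^ (r - i) • orbitVector σ v r (ζ ^ k) =
      (r : ℂ) • Pi.single (σ^[i] v) 1 := by
  ext x
  simp only [Finset.sum_apply, Pi.smul_apply, orbitVector, smul_eq_mul, Finset.mul_sum]
  rw [Finset.sum_comm]
  have h : ∀ j ∈ Finset.range r, ∑ k ∈ Finset.range r,
      (ζ ^ k) ^ (r - i) * (if σ^[j] v = x then (ζ ^ k) ^ j else 0) =
      if j = i then (if σ^[i] v = x then (r : ℂ) else 0) else 0 := by
    intro j hj
    rw [Finset.mem_range] at hj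
    have hsum : ∑ k ∈ Finset.range r, (ζ ^ k) ^ (r - i) * (ζ ^ k) ^ j =
        if j = i then (r : ℂ) else 0 := by
      have : ∀ k, (ζ ^ k) ^ (r - i) * (ζ ^ k) ^ j = (ζ ^ (r - i + j)) ^ k := fun k => by
        rw [← pow_add, ← pow_mul, ← pow_mul, mul_comm]
      simp_rw [this]
      split_ifs with hji
      · subst hji
        rw [Nat.sub_add_cancel hj.le, hζ.pow_eq_one]
        simp
      · have hne : ζ ^ (r - i + j) ≠ 1 := by
          rw [Ne, hζ.pow_eq_one_iff_dvd]
          rintro ⟨c, hc⟩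
          have : c < 2 := by by_contra hc2; nlinarith [Nat.sub_le r i]
          interval_cases c <;> omega
        rw [geom_sum_eq hne, ← pow_mul, mul_comm, pow_mul, hζ.pow_eq_one, one_pow, sub_self,
          zero_div]
    split_ifs at hsum ⊢ with h1 h2 h3 h4 <;> simp_all
  rw [Finset.sum_congr rfl h, Finset.sum_ite_eq' , if_pos (Finset.mem_range.2 hi), Pi.single_apply]
  simp [eq_comm]

end OrbitVector

theorem sum_finrank_le_of_le_eigenspace {V : Type*} [Fintype V] {r : ℕ}
    (φ : Module.End ℂ (V → ℂ)) (ω : Fin r → ℂ) (hω : Function.Injective ω)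
    (N : Fin r → Submodule ℂ (V → ℂ)) (hN : ∀ k, N k ≤ φ.eigenspace (ω k)) :
    ∑ k, Module.finrank ℂ (N k) ≤ Fintype.card V := by
  classical
  have hind : iSupIndep N := (φ.eigenspaces_iSupIndep.comp hω).mono hN
  have h := LinearMap.finrank_le_finrank_of_injective hind.dfinsupp_lsum_injective
  rw [Module.finrank_fintype_fun_eq_card] at h
  exact (Module.finrank_directSum ℂ fun k => ↥(N k)).symm.trans_le h

section Algebraic

open Polynomial

/-- A monic factor of a monic rational polynomial has algebraic coefficients. -/
theorem mem_lifts_algebraicClosure_of_dvd {p : ℂ[X]} (hp : p.Monic) {f : ℚ[X]} (hf : f.Monic)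
    (h : p ∣ f.map (algebraMap ℚ ℂ)) :
    p ∈ lifts (algebraMap (algebraicClosure ℚ ℂ) ℂ) := by
  have h1 := integralClosure.mem_lifts_of_monic_of_dvd_map ℂ hf hp h
  rw [lifts_iff_coeff_lifts] at h1 ⊢
  intro n
  obtain ⟨y, hy⟩ := h1 n
  exact ⟨⟨p.coeff n, mem_algebraicClosure_iff.2 (hy ▸ y.2.isAlgebraic)⟩, rfl⟩

theorem transcendental_algebraicClosure {Q : ℝ} (hQ : Transcendental ℚ Q) :
    Transcendental (algebraicClosure ℚ ℂ) (Q : ℂ) := by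
  intro h
  have : Algebra.IsAlgebraic ℚ (algebraicClosure ℚ ℂ) := algebraicClosure.isAlgebraic ℚ ℂ
  have h1 : IsAlgebraic ℚ (Q : ℂ) := h.restrictScalars ℚ
  exact hQ ((isAlgebraic_algebraMap_iff (algebraMap ℝ ℂ).injective).1 h1)

end Algebraic

/-! ### The adjacency matrix and an orbit of an automorphism -/

theorem exists_iterate_of_orbit {V : Type*} [Fintype V] [DecidableEq V] {G : SimpleGraph V}
    {T : G ≃g G} {K : Finset V} {v : V}
    (hK : (K : Set V) = MulAction.orbit (Subgroup.zpowers T) v) :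
    0 < orderOf T ∧ T^[orderOf T] v = v ∧
      ∀ x, x ∈ K ↔ ∃ j < orderOf T, T^[j] v = x := by
  have : Finite (G ≃g G) :=
    Finite.of_injective (fun f : G ≃g G => (f : V → V)) DFunLike.coe_injective
  have hpow : ∀ j, ∀ x, (T ^ j) x = T^[j] x := by
    intro j
    induction j with
    | zero => intro x; rfl
    | succ j ih => intro x; rw [pow_succ, Function.iterate_succ_apply, ← ih]; rfl
  have hpos := orderOf_pos T
  refine ⟨hpos, by rw [← hpow, pow_orderOf_eq_one]; rfl, fun x => ?_⟩
  rw [← Finset.mem_coe, hK, MulAction.mem_orbit_iff]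
  constructor
  · rintro ⟨⟨g, hg⟩, rfl⟩
    obtain ⟨j, hj, rfl⟩ := (mem_zpowers_iff_mem_range_orderOf.trans Finset.mem_image).1 hg
    exact ⟨j, Finset.mem_range.1 hj, (hpow j v).symm⟩
  · rintro ⟨j, -, rfl⟩
    exact ⟨⟨T ^ j, Subgroup.npow_mem_zpowers T j⟩, hpow j v⟩

theorem injOn_iterate_of_card {V : Type*} [DecidableEq V] {σ : V → V} {v : V} {r : ℕ}
    {K : Finset V} (hK : ∀ x, x ∈ K ↔ ∃ j < r, σ^[j] v = x) (hr : K.card = r) :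
    Set.InjOn (fun j => σ^[j] v) (Finset.range r : Set ℕ) := by
  have : K = (Finset.range r).image fun j => σ^[j] v := by
    ext x; simp [hK]
  rw [← Finset.card_image_iff, ← this, hr, Finset.card_range]

section Orbit

variable {V : Type*} [Fintype V] [DecidableEq V] {G : SimpleGraph V} [DecidableRel G.Adj]
  {T : G ≃g G} {r : ℕ} {v : V} {K : Finset V} {ω : ℂ}

omit [DecidableEq V] in
theorem adjMatrix_mulVec_comp {w : V → ℂ} (hw : ∀ x, w (T x) = ω * w x) (x : V) :
    (G.adjMatrix ℂ *ᵥ w) (T x) = ω * (G.adjMatrix ℂ *ᵥ w) x := by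
  simp only [Matrix.mulVec, dotProduct, Finset.mul_sum]
  rw [← T.toEquiv.sum_comp]
  refine Finset.sum_congr rfl fun y _ => ?_
  have h1 : G.adjMatrix ℂ (T x) (T.toEquiv y) = G.adjMatrix ℂ x y := by
    simp only [SimpleGraph.adjMatrix_apply]
    exact if_congr T.map_adj_iff rfl rfl
  have h2 : w (T.toEquiv y) = ω * w y := hw y
  rw [h1, h2]; ring

theorem krylov_adjMatrix_le {u : V → ℂ} (hu : ∀ x, u (T x) = ω * u x) :
    krylov (G.adjMatrix ℂ) u ≤ Module.End.eigenspace (LinearMap.funLeft ℂ ℂ T) ω := by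
  have hmem : ∀ w : V → ℂ, w ∈ Module.End.eigenspace (LinearMap.funLeft ℂ ℂ T) ω ↔
      ∀ x, w (T x) = ω * w x := fun w => by
    rw [Module.End.mem_eigenspace_iff, funext_iff]; rfl
  exact krylov_le ((hmem _).2 hu) fun w hw => (hmem _).2 (adjMatrix_mulVec_comp ((hmem _).1 hw))

theorem comp_eq_of_mem_krylov {u : V → ℂ} (hu : ∀ x, u (T x) = ω * u x) {w : V → ℂ}
    (hw : w ∈ krylov (G.adjMatrix ℂ) u) (x : V) : w (T x) = ω * w x :=
  congrFun (Module.End.mem_eigenspace_iff.1 (krylov_adjMatrix_le hu hw)) x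

omit [DecidableRel G.Adj] in
/-- On an eigenspace of the automorphism the matrix `D_K` has rank one. -/
theorem diagonal_mulVec_eq_smul (hK : ∀ x, x ∈ K ↔ ∃ j < r, T^[j] v = x) {u w : V → ℂ}
    (hu : ∀ x, u (T x) = ω * u x) (hu1 : u v = 1) (hu0 : ∀ x ∉ K, u x = 0)
    (hw : ∀ x, w (T x) = ω * w x) :
    Matrix.diagonal (fun x => if x ∈ K then (1 : ℂ) else 0) *ᵥ w = w v • u := by
  ext x
  rw [Matrix.mulVec_diagonal, Pi.smul_apply, smul_eq_mul]
  split_ifs with hx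
  · obtain ⟨j, -, rfl⟩ := (hK x).1 hx
    rw [apply_iterate_of_apply_comp hw, apply_iterate_of_apply_comp hu, hu1]; ring
  · rw [hu0 x hx, zero_mul, mul_zero]

omit [DecidableRel G.Adj] in
theorem star_dotProduct_eq_zero (hK : ∀ x, x ∈ K ↔ ∃ j < r, T^[j] v = x) {u w : V → ℂ}
    (hu0 : ∀ x ∉ K, u x = 0) (hw : ∀ x, w (T x) = ω * w x) (hwv : w v = 0) :
    star w ⬝ᵥ u = 0 := by
  refine Finset.sum_eq_zero fun x _ => ?_
  by_cases hx : x ∈ K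
  · obtain ⟨j, -, rfl⟩ := (hK x).1 hx
    rw [Pi.star_apply, apply_iterate_of_apply_comp hw, hwv, mul_zero, star_zero, zero_mul]
  · rw [hu0 x hx, mul_zero]

omit [Fintype V] [DecidableEq V] in
theorem isHermitian_adjMatrix : (G.adjMatrix ℂ).IsHermitian := by
  ext x y
  simp only [Matrix.conjTranspose_apply, SimpleGraph.adjMatrix_apply, G.adj_comm y x]
  split_ifs <;> simp

omit [Fintype V] in
theorem map_perturbation (Q : ℝ) :
    (G.adjMatrix ℝ + Q • diagIndicator K).map (fun a : ℝ => (a : ℂ)) =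
      G.adjMatrix ℂ + (Q : ℂ) • Matrix.diagonal (fun x => if x ∈ K then (1 : ℂ) else 0) := by
  ext x y
  by_cases hxy : x = y
  · subst hxy; by_cases hx : x ∈ K <;> simp [diagIndicator, hx]
  · by_cases h : G.Adj x y <;> simp [diagIndicator, hxy, SimpleGraph.adjMatrix_apply, h]

omit [Fintype V] in
theorem isHermitian_perturbation (Q : ℝ) :
    ((G.adjMatrix ℝ + Q • diagIndicator K).map (fun a : ℝ => (a : ℂ))).IsHermitian := by
  have h : (G.adjMatrix ℝ + Q • diagIndicator K).IsSymm := by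
    refine G.isSymm_adjMatrix.add (Matrix.IsSymm.smul ?_ Q)
    exact Matrix.isSymm_diagonal _
  ext x y
  simp [Matrix.conjTranspose_apply, Complex.conj_ofReal, ← h.apply x y]

theorem adjMatrix_pow_mulVec_mem {F : Type*} [Field F] [Algebra F ℂ] {u : V → ℂ}
    (hu : ∀ x, u x ∈ (algebraMap F ℂ).range) (k : ℕ) (x : V) :
    (G.adjMatrix ℂ ^ k *ᵥ u) x ∈ (algebraMap F ℂ).range := by
  induction k generalizing x with
  | zero => simpa using hu x
  | succ k ih =>
    rw [pow_succ', ← Matrix.mulVec_mulVec, SimpleGraph.adjMatrix_mulVec_apply]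
    exact sum_mem fun y _ => ih y

open Polynomial in
theorem charpoly_adjMatrix : (G.adjMatrix ℂ).charpoly =
    (G.adjMatrix ℚ).charpoly.map (algebraMap ℚ ℂ) := by
  rw [← Matrix.charpoly_map]
  congr 1
  ext x y
  simp [SimpleGraph.adjMatrix_apply, apply_ite]

theorem adjMatrix_pow_mulVec_indicator (K : Finset V) (k : ℕ) (x : V) :
    (G.adjMatrix ℂ ^ k *ᵥ fun y => if y ∈ K then 1 else 0) x =
      ((∑ y ∈ K, Fintype.card {p : G.Walk x y | p.length = k} : ℕ) : ℂ) := by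
  simp [Matrix.mulVec, dotProduct, SimpleGraph.adjMatrix_pow_apply_eq_card_walk]

open Polynomial in
/-- The entry at `x` of `M ^ i` applied to the indicator of `K` counts the walks of length `i` from
`x` to `K`. It vanishes for `i < d` but not for `i = d`, which no monic relation of degree at most
`d` allows. -/
theorem lt_natDegree_of_distFromSet {x : V} {d : ℕ} (hd : distFromSet G K x = d) {p : ℂ[X]}
    (hp : p.Monic)
    (hpk : krylovMap (G.adjMatrix ℂ) (fun y => if y ∈ K then 1 else 0) p = 0) :
    d < p.natDegree := by
  by_contra! hle
  set u : V → ℂ := fun y => if y ∈ K then 1 else 0 with hu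
  have hg : krylovMap (G.adjMatrix ℂ) u (X ^ (d - p.natDegree) * p) = 0 := by
    rw [krylovMap_mul, hpk, Matrix.mulVec_zero]
  have hgm : (X ^ (d - p.natDegree) * p).Monic := (monic_X_pow _).mul hp
  have hgd : (X ^ (d - p.natDegree) * p).natDegree = d := by
    rw [(monic_X_pow _).natDegree_mul hp, natDegree_X_pow]; omega
  set g := X ^ (d - p.natDegree) * p
  have hlow : ∀ i < d, (G.adjMatrix ℂ ^ i *ᵥ u) x = 0 := by
    intro i hi
    rw [hu, adjMatrix_pow_mulVec_indicator, Nat.cast_eq_zero]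
    refine Finset.sum_eq_zero fun y hy => Fintype.card_eq_zero_iff.2 ⟨fun p => ?_⟩
    have h1 : (d : ℕ∞) ≤ G.edist y x := hd ▸ iInf₂_le y hy
    have h2 := h1.trans p.1.reverse.edist_le
    rw [SimpleGraph.Walk.length_reverse, p.2, Nat.cast_le] at h2
    omega
  have htop : (G.adjMatrix ℂ ^ d *ᵥ u) x ≠ 0 := by
    rw [hu, adjMatrix_pow_mulVec_indicator, Nat.cast_ne_zero]
    have hKne : K.Nonempty := by
      rw [Finset.nonempty_iff_ne_empty]
      rintro rfl
      simp [distFromSet] at hd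
    obtain ⟨y, hy, hmin⟩ := K.exists_min_image (fun y => G.edist y x) hKne
    have h1 : G.edist y x = d := by
      rw [← hd]
      exact le_antisymm (le_iInf₂ hmin) (iInf₂_le y hy)
    obtain ⟨q, hq⟩ := SimpleGraph.exists_walk_of_edist_ne_top (G := G) (u := y) (v := x)
      (by rw [h1]; exact ENat.natCast_ne_top d)
    rw [h1, Nat.cast_inj] at hq
    have : 0 < Fintype.card {p : G.Walk x y | p.length = d} :=
      Fintype.card_pos_iff.2 ⟨q.reverse, by simp [hq]⟩
    exact (this.trans_le (Finset.single_le_sum (f := fun y =>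
      Fintype.card {p : G.Walk x y | p.length = d}) (fun _ _ => Nat.zero_le _) hy)).ne'
  apply htop
  have h := congrFun hg x
  rw [krylovMap_apply, aeval_eq_sum_range, hgd, Finset.sum_range_succ, ← hgd, hgm.coeff_natDegree,
    hgd, one_smul, Matrix.add_mulVec, Pi.add_apply, Matrix.sum_mulVec, Finset.sum_apply,
    Finset.sum_eq_zero, zero_add] at h
  · exact h
  · intro i hi
    rw [Matrix.smul_mulVec, Pi.smul_apply, hlow i (Finset.mem_range.1 hi), smul_zero]

end Orbit

/-! ### Fractional revival on an orbit -/

section Revival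

variable {V : Type*} [Fintype V] [DecidableEq V] {G : SimpleGraph V} [DecidableRel G.Adj]
  {T : G ≃g G} {r : ℕ} {v : V} {K : Finset V}

/-- The algebraic heart of the argument: a single additive function takes the value `1 / n` at every
eigenvalue (from a prescribed finite set) of the perturbed matrix on the Krylov space of the orbit
vector of a root of unity `ω`, where `n` is the dimension of that space. -/
theorem exists_additive_apply_eigenvalue_eq (hr : 0 < r) (hTr : T^[r] v = v)
    (hK : ∀ x, x ∈ K ↔ ∃ j < r, T^[j] v = x) (hKr : K.card = r) {Q : ℝ}
    (hQ : Transcendental ℚ Q) (S : Finset ℝ) :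
    ∃ g : ℝ →+ ℝ, ∀ ω : ℂ, ω ^ r = 1 → ∀ p : Polynomial ℂ, p.Monic →
      (∀ h, krylovMap (G.adjMatrix ℂ) (orbitVector T v r ω) h = 0 ↔ p ∣ h) →
      ∀ μ ∈ S, ∀ w ∈ krylov (G.adjMatrix ℂ) (orbitVector T v r ω), w ≠ 0 →
        (G.adjMatrix ℂ + (Q : ℂ) • Matrix.diagonal fun x => if x ∈ K then (1 : ℂ) else 0) *ᵥ w =
          (μ : ℂ) • w → g μ = 1 / p.natDegree := by
  classical
  let F := algebraicClosure ℚ ℂ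
  obtain ⟨f, hf⟩ := exists_linearMap_mul_natDegree_eq_one (transcendental_algebraicClosure hQ)
    (S.image fun μ : ℝ => (μ : ℂ))
  refine ⟨AddMonoidHom.mk' (fun x => ((f (x : ℂ) : ℂ)).re) fun x y => by simp, ?_⟩
  intro ω hω p hp hpk μ hμ w hw hw0 hAw
  have hinj := injOn_iterate_of_card hK hKr
  have hu := orbitVector_comp T.injective hTr hω
  have hu1 : orbitVector T v r ω v = 1 := orbitVector_self hr hinj
  have hu0 : ∀ x ∉ K, orbitVector T v r ω x = 0 := fun x hx =>
    orbitVector_eq_zero fun j hj h => hx ((hK x).2 ⟨j, hj, h⟩)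
  have horth : ∀ w ∈ krylov (G.adjMatrix ℂ) (orbitVector T v r ω), w v = 0 →
      star w ⬝ᵥ orbitVector T v r ω = 0 := fun w hw hwv =>
    star_dotProduct_eq_zero hK hu0 (comp_eq_of_mem_krylov hu hw) hwv
  have hD : ∀ w ∈ krylov (G.adjMatrix ℂ) (orbitVector T v r ω),
      Matrix.diagonal (fun x => if x ∈ K then (1 : ℂ) else 0) *ᵥ w =
        w v • orbitVector T v r ω := fun w hw =>
    diagonal_mulVec_eq_smul hK hu hu1 hu0 (comp_eq_of_mem_krylov hu hw)
  have hp0 : p.natDegree ≠ 0 := by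
    intro h
    have h1 := (hpk 1).2 (by rw [hp.natDegree_eq_zero.1 h])
    rw [krylovMap_apply, map_one, Matrix.one_mulVec] at h1
    rw [h1] at hu1
    exact zero_ne_one hu1
  have hωF : ω ∈ (algebraMap F ℂ).range :=
    ⟨⟨ω, mem_algebraicClosure_iff.2 (IsIntegral.of_pow hr
      (by rw [hω]; exact isIntegral_one)).isAlgebraic⟩, rfl⟩
  have huF : ∀ x, orbitVector T v r ω x ∈ (algebraMap F ℂ).range := fun x =>
    sum_mem fun j _ => by
      split_ifs
      exacts [pow_mem hωF j, zero_mem _]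
  have hpF : p ∈ Polynomial.lifts (algebraMap F ℂ) := by
    refine mem_lifts_algebraicClosure_of_dvd hp (G.adjMatrix ℚ).charpoly_monic ?_
    rw [← charpoly_adjMatrix, ← hpk, krylovMap_apply, Matrix.aeval_self_charpoly,
      Matrix.zero_mulVec]
  have hqF := krylovNumerator_mem_lifts (u := orbitVector T v r ω) v hpF
    fun k => adjMatrix_pow_mulVec_mem (G := G) huF k v
  obtain ⟨hqm, hqd⟩ := krylovNumerator_monic (M := G.adjMatrix ℂ) hu1 hp hp0
  have hcop := isCoprime_krylovNumerator isHermitian_adjMatrix horth hp hpk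
  have heq := eval_eq_of_eigenvector isHermitian_adjMatrix hD horth hpk hw hw0 hAw
  set q := krylovNumerator (G.adjMatrix ℂ) (orbitVector T v r ω) v p
  obtain ⟨p', hp'⟩ := (Polynomial.mem_lifts p).1 hpF
  obtain ⟨q', hq'⟩ := (Polynomial.mem_lifts q).1 hqF
  have hinjF := (algebraMap F ℂ).injective
  have hone := hf _ (Finset.mem_image_of_mem _ hμ) p' q'
    (Polynomial.monic_of_injective hinjF (hp'.symm ▸ hp))
    (Polynomial.monic_of_injective hinjF (hq'.symm ▸ hqm))
    (by rw [← Polynomial.natDegree_map (algebraMap F ℂ), hq',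
      ← Polynomial.natDegree_map (p := p') (algebraMap F ℂ), hp', hqd])
    ((Polynomial.isCoprime_map (algebraMap F ℂ)).1 (by rwa [hp', hq']))
    (by rw [← Polynomial.eval_map_algebraMap, ← Polynomial.eval_map_algebraMap, hp', hq', heq])
  rw [← Polynomial.natDegree_map (algebraMap F ℂ), hp'] at hone
  have hone' : (f (μ : ℂ) : ℂ) *
      p.natDegree = 1 := by
    have := congrArg (algebraMap F ℂ) hone
    simpa using this
  have hval : (f (μ : ℂ) : ℂ) =
      ((1 / p.natDegree : ℝ) : ℂ) := by
    have : (p.natDegree : ℂ) ≠ 0 := Nat.cast_ne_zero.2 hp0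
    push_cast
    rw [eq_div_iff this, hone']
  change (f (μ : ℂ) : ℂ).re = _
  rw [hval, Complex.ofReal_re]

/-- A unitary matrix that maps the functions supported on `K` to themselves has a unitary `K × K`
block. -/
theorem restrictTo_mem_unitaryGroup {Z : Matrix V V ℂ} (hZ : Z ∈ Matrix.unitaryGroup V ℂ)
    (h : ∀ x ∉ K, ∀ y ∈ K, Z x y = 0) : restrictTo K Z ∈ Matrix.unitaryGroup K ℂ := by
  rw [Matrix.mem_unitaryGroup_iff'] at hZ ⊢
  ext a b
  have h1 := congrFun (congrFun hZ a) b
  rw [Matrix.mul_apply] at h1 ⊢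
  rw [Matrix.one_apply] at h1 ⊢
  simp only [Matrix.star_apply, ← Subtype.ext_iff] at h1 ⊢
  rw [← h1, ← Finset.sum_subset K.subset_univ fun x _ hx => by rw [h x hx b b.2, mul_zero],
    ← Finset.sum_coe_sort K]
  rfl

theorem restrictTo_mem_closure {A : Matrix V V ℝ} {Z : Matrix V V ℂ}
    (hZ : Z ∈ closure {B | ∃ t : ℝ, 0 ≤ t ∧ B = quantumWalk A t}) :
    restrictTo K Z ∈
      closure {B : Matrix K K ℂ | ∃ t : ℝ, 0 ≤ t ∧ B = restrictTo K (quantumWalk A t)} := by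
  have hc : Continuous fun B : Matrix V V ℂ => restrictTo K B :=
    continuous_id.matrix_submatrix _ _
  refine closure_mono ?_ (image_closure_subset_closure_image hc ⟨Z, hZ, rfl⟩)
  rintro _ ⟨_, ⟨t, ht, rfl⟩, rfl⟩
  exact ⟨t, ht, rfl⟩

theorem eq_of_restrictTo_eq_smul_one {Z : Matrix V V ℂ} {ρ z : ℂ}
    (hρ : restrictTo K Z = ρ • (1 : Matrix K K ℂ)) {u : V → ℂ} (hu0 : ∀ x ∉ K, u x = 0)
    (hv : v ∈ K) (hu1 : u v = 1) (hZu : Z *ᵥ u = z • u) : ρ = z := by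
  have h := congrFun hZu v
  rw [Matrix.mulVec, dotProduct, ← Finset.sum_subset K.subset_univ
    fun x _ hx => by rw [hu0 x hx, mul_zero], ← Finset.sum_coe_sort K, Pi.smul_apply, hu1] at h
  have h2 : ∀ x : K, Z v x = ρ * if (⟨v, hv⟩ : K) = x then 1 else 0 := fun x =>
    (congrFun (congrFun hρ ⟨v, hv⟩) x).trans (by simp [Matrix.one_apply])
  simp_rw [h2] at h
  simpa [hu1] using h

/-- The Krylov spaces of the orbit vectors lie in different eigenspaces of the automorphism. If all
had the dimension found for the root of unity `1`, which exceeds `d`, they would not fit into the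
space of functions on `V`. -/
theorem exists_natDegree_ne {ζ : ℂ} (hζ : IsPrimitiveRoot ζ r) (hr : 0 < r) (hTr : T^[r] v = v)
    (hK : ∀ x, x ∈ K ↔ ∃ j < r, T^[j] v = x) (hKr : K.card = r) {d : ℕ} {x : V}
    (hd : distFromSet G K x = d) (hrd : Fintype.card V < r * (d + 1)) (p : ℕ → Polynomial ℂ)
    (hp : ∀ k, (p k).Monic)
    (hpk : ∀ k h, krylovMap (G.adjMatrix ℂ) (orbitVector T v r (ζ ^ k)) h = 0 ↔ p k ∣ h) :
    ∃ k, (p k).natDegree ≠ (p 0).natDegree := by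
  by_contra! hcon
  have hone : orbitVector T v r (ζ ^ 0) = fun y => if y ∈ K then 1 else 0 := by
    ext y
    have hinj := injOn_iterate_of_card hK hKr
    have hu : ∀ x, orbitVector T v r 1 (T x) = 1 * orbitVector T v r 1 x :=
      orbitVector_comp T.injective hTr (one_pow r)
    rw [pow_zero]
    split_ifs with hy
    · obtain ⟨j, -, rfl⟩ := (hK y).1 hy
      rw [apply_iterate_of_apply_comp hu, orbitVector_self hr hinj, one_pow, one_mul]
    · exact orbitVector_eq_zero fun j hj h => hy ((hK y).2 ⟨j, hj, h⟩)
  have hlt : d < (p 0).natDegree := by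
    refine lt_natDegree_of_distFromSet hd (hp 0) ?_
    rw [← hone, hpk]
  have hsum := sum_finrank_le_of_le_eigenspace (LinearMap.funLeft ℂ ℂ T)
    (fun k : Fin r => ζ ^ (k : ℕ))
    (fun a b hab => Fin.ext (hζ.pow_inj a.2 b.2 hab))
    (fun k => krylov (G.adjMatrix ℂ) (orbitVector T v r (ζ ^ (k : ℕ))))
    (fun k => krylov_adjMatrix_le (orbitVector_comp T.injective hTr
      (by rw [← pow_mul, mul_comm, pow_mul, hζ.pow_eq_one, one_pow])))
  have hge : ∑ _k : Fin r, (d + 1) ≤ Fintype.card V := by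
    refine (Finset.sum_le_sum fun k _ => ?_).trans hsum
    refine le_trans ?_ (natDegree_le_finrank_krylov (hp k) (hpk k))
    rw [hcon]
    exact hlt
  rw [Finset.sum_const, Finset.card_univ, Fintype.card_fin, smul_eq_mul] at hge
  omega

end Revival

theorem mainTheorem7 {V : Type*} [Fintype V] [DecidableEq V]
    (G : SimpleGraph V) [DecidableRel G.Adj]
    (T : G ≃g G) (r : ℕ) (hT : orderOf T = r)
    (K : Finset V) (hK : ∃ v : V, (K : Set V) = MulAction.orbit (Subgroup.zpowers T) v)
    (hKr : K.card = r)
    (d : ℕ) (hd : IsGreatest {n : ℕ | ∃ x : V, distFromSet G K x = (n : ℕ∞)} d)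
    (hrd : Fintype.card V < r * (d + 1))
    (Q : ℝ) (hQ : Transcendental ℚ Q) :
    PrettyGoodFractionalRevival (G.adjMatrix ℝ + Q • diagIndicator K) K := by
  obtain ⟨v, hv⟩ := hK
  obtain ⟨x, hx⟩ := hd.1
  obtain ⟨hr, hTr, hKmem⟩ := exists_iterate_of_orbit hv
  rw [hT] at hr hTr hKmem
  have hinj := injOn_iterate_of_card hKmem hKr
  have hζ := Complex.isPrimitiveRoot_exp r hr.ne'
  set ζ := Complex.exp (2 * Real.pi * Complex.I / r)
  have hζk : ∀ k, (ζ ^ k) ^ r = 1 := fun k => by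
    rw [← pow_mul, mul_comm, pow_mul, hζ.pow_eq_one, one_pow]
  choose p hp hpk using fun k =>
    exists_monic_krylovMap_eq_zero_iff (G.adjMatrix ℂ) (orbitVector T v r (ζ ^ k))
  obtain ⟨k, hk⟩ := exists_natDegree_ne hζ hr hTr hKmem hKr hx hrd p hp hpk
  have hA := isHermitian_perturbation (G := G) (K := K) Q
  obtain ⟨g, hg⟩ := exists_additive_apply_eigenvalue_eq (G := G) hr hTr hKmem hKr hQ
    (Finset.univ.image hA.eigenvalues)
  have hu0 : ∀ k, ∀ x ∉ K, orbitVector T v r (ζ ^ k) x = 0 := fun k x hx =>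
    orbitVector_eq_zero fun j hj h => hx ((hKmem x).2 ⟨j, hj, h⟩)
  have hu1 : ∀ k, orbitVector T v r (ζ ^ k) v = 1 := fun k => orbitVector_self hr hinj
  -- the scaling that separates the two phases by a half turn
  set s : ℝ := Real.pi / (1 / (p k).natDegree - 1 / (p 0).natDegree) with hs
  obtain ⟨Z, hZu, hZc, hZ⟩ :=
    exists_unitary_mem_closure_quantumWalk hA ((AddMonoidHom.mulLeft s).comp g)
  have hphase : ∀ k, Z *ᵥ orbitVector T v r (ζ ^ k) =
      Complex.exp (Complex.I * (s * (1 / (p k).natDegree) : ℝ)) • orbitVector T v r (ζ ^ k) := by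
    intro k
    have hu := orbitVector_comp T.injective hTr (hζk k)
    have hle : krylov (G.adjMatrix ℂ) (orbitVector T v r (ζ ^ k)) ≤
        Module.End.eigenspace Z.toLin'
          (Complex.exp (Complex.I * (s * (1 / (p k).natDegree) : ℝ))) := by
      refine le_of_forall_eigenvector hA (fun w hw => ?_) fun i w hw hw0 hAw => ?_
      · rw [map_perturbation, Matrix.add_mulVec, Matrix.smul_mulVec,
          diagonal_mulVec_eq_smul hKmem hu (hu1 k) (hu0 k) (comp_eq_of_mem_krylov hu hw)]
        exact add_mem (mulVec_mem_krylov hw)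
          (Submodule.smul_mem _ _ (Submodule.smul_mem _ _ self_mem_krylov))
      · rw [Module.End.mem_eigenspace_iff, Matrix.toLin'_apply, hZ i w hAw,
          AddMonoidHom.comp_apply, hg _ (hζk k) (p k) (hp k) (hpk k) _
            (Finset.mem_image_of_mem _ (Finset.mem_univ i)) w hw hw0
            (by rw [← map_perturbation, hAw])]
        rfl
    have := Module.End.mem_eigenspace_iff.1 (hle self_mem_krylov)
    rwa [Matrix.toLin'_apply] at this
  have hZK : ∀ x ∉ K, ∀ y ∈ K, Z x y = 0 := by
    intro x hx y hy
    obtain ⟨i, hi, rfl⟩ := (hKmem y).1 hy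
    have h := congrArg (fun w => (Z *ᵥ w) x) (sum_orbitVector (σ := T) (v := v) hζ hi)
    simp only [Matrix.mulVec_sum, Matrix.mulVec_smul, hphase, Finset.sum_apply, Pi.smul_apply,
      hu0 _ x hx, mul_zero, Finset.sum_const_zero, Matrix.mulVec_single_one, Matrix.col_apply,
      smul_eq_mul] at h
    exact (mul_eq_zero.1 h.symm).resolve_left (Nat.cast_ne_zero.2 hr.ne')
  intro hsub
  obtain ⟨ρ, hρ⟩ := hsub ⟨restrictTo_mem_closure hZc, restrictTo_mem_unitaryGroup hZu hZK⟩
  have hvK : v ∈ K := (hKmem v).2 ⟨0, hr, rfl⟩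
  have h0 := eq_of_restrictTo_eq_smul_one hρ (hu0 0) hvK (hu1 0) (hphase 0)
  have h1 := eq_of_restrictTo_eq_smul_one hρ (hu0 k) hvK (hu1 k) (hphase k)
  have hne : (1 / (p k).natDegree - 1 / (p 0).natDegree : ℝ) ≠ 0 := by
    rw [sub_ne_zero, one_div, one_div, Ne, inv_inj, Nat.cast_inj]
    exact hk
  have hrot : Complex.I * (s * (1 / (p k).natDegree) : ℝ) =
      Complex.I * (s * (1 / (p 0).natDegree) : ℝ) + Real.pi * Complex.I := by
    have : s * (1 / (p k).natDegree - 1 / (p 0).natDegree) = Real.pi := by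
      rw [hs, div_mul_cancel₀ _ hne]
    have h2 : s * (1 / (p k).natDegree) = s * (1 / (p 0).natDegree) + Real.pi := by
      rw [← this]; ring
    rw [h2, Complex.ofReal_add]; ring
  rw [hrot, Complex.exp_add, Complex.exp_pi_mul_I, ← h0, mul_neg, mul_one] at h1
  have hρ0 : ρ = 0 := self_eq_neg.1 h1
  exact Complex.exp_ne_zero _ (h0.symm.trans hρ0)
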